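/- **Language.** Fix predicate symbols of each finite arity. Ecumenical first-order formulas (identified up to renaming of bound variables) are built from atoms $p_i(\vec x)$ (intuitionistic) and $p_c(\vec x)$ (classical) for each predicate symbol $p$, where $\vec x$ are variables (there are no function symbols), by the neutral $\bot,\neg,\wedge,\forall$, the intuitionistic $\to_i,\vee_i,\exists_i$ and the classical $\to_c,\vee_c,\exists_c$. A formula is *negative* if it is an atom $p_c(\vec x)$ or its main connective is $\neg,\to_c,\vee_c$ or $\exists_c$; otherwise it is *positive*. Below, $p$ stands for an atom (its arguments are suppressed), $y$ for a variable, and "$S_1\;|\;S_2\ \Rightarrow\ S$" for the rule with premises $S_1,S_2$ and conclusion $S$. Rules marked $(*)$ require that $y$ is not free in the conclusion. **System LE.** Sequents $\Gamma\vdash C$ with $\Gamma$ a finite multiset of formulas and $C$ a formula. Rules: - $A,B,\Gamma\vdash C\Rightarrow A\wedge B,\Gamma\vdash C$; $\ \Gamma\vdash A\;|\;\Gamma\vdash B\Rightarrow\Gamma\vdash A\wedge B$; - $A,\Gamma\vdash C\;|\;B,\Gamma\vdash C\Rightarrow A\vee_i B,\Gamma\vdash C$; $\ \Gamma\vdash A_j\Rightarrow\Gamma\vdash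 A_1\vee_i A_2$ ($j=1,2$); - $A\to_i B,\Gamma\vdash A\;|\;B,\Gamma\vdash C\Rightarrow A\to_i B,\Gamma\vdash C$; $\ \Gamma,A\vdash B\Rightarrow\Gamma\vdash A\to_i B$; - $\neg A,\Gamma\vdash A\Rightarrow\neg A,\Gamma\vdash\bot$; $\ \Gamma,A\vdash\bot\Rightarrow\Gamma\vdash\neg A$; $\ \bot,\Gamma\vdash A$ (axiom); - $A[y/x],\forall x.A,\Gamma\vdash C\Rightarrow\forall x.A,\Gamma\vdash C$; $\ \Gamma\vdash A[y/x]\Rightarrow\Gamma\vdash\forall x.A\ (*)$; - $A[y/x],\Gamma\vdash C\Rightarrow\exists_i x.A,\Gamma\vdash C\ (*)$; $\ \Gamma\vdash A[y/x]\Rightarrow\Gamma\vdash\exists_i x.A$; - $A,\Gamma\vdash\bot\;|\;B,\Gamma\vdash\bot\Rightarrow A\vee_c B,\Gamma\vdash\bot$; $\ \Gamma,\neg A,\neg B\vdash\bot\Rightarrow\Gamma\vdash A\vee_c B$; - $A\to_c B,\Gamma\vdash A\;|\;B,\Gamma\vdash\bot\Rightarrow A\to_c B,\Gamma\vdash\bot$;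 $\ \Gamma,A,\neg B\vdash\bot\Rightarrow\Gamma\vdash A\to_c B$; - $p_i,\Gamma\vdash\bot\Rightarrow p_c,\Gamma\vdash\bot$; $\ \Gamma,\neg p_i\vdash\bot\Rightarrow\Gamma\vdash p_c$; - $A[y/x],\Gamma\vdash\bot\Rightarrow\exists_c x.A,\Gamma\vdash\bot\ (*)$; $\ \Gamma,\forall x.\neg A\vdash\bot\Rightarrow\Gamma\vdash\exists_c x.A$; - $p_i,\Gamma\vdash p_i$ (axiom); $\ \Gamma\vdash A\;|\;A,\Gamma\vdash C\Rightarrow\Gamma\vdash C$ (cut); $\ \Gamma\vdash\bot\Rightarrow\Gamma\vdash A$. **System LCE.** Sequents $\Gamma\vdash\Delta;\Pi$ with $\Gamma,\Delta$ finite sets of formulas and the stoup $\Pi$ either empty ($\cdot$) or a single formula. Rules ($P$ positive, $N$ negative): - $\Gamma,A,B\vdash\Delta;\Pi\Rightarrow\Gamma,A\wedge B\vdash\Delta;\Pi$; $\ \Gamma\vdash\Delta;A\;|\;\Gamma\vdash\Delta;B\Rightarrow\Gamma\vdash\Delta;A\wedge B$; - $\Gamma,A\vdash\Delta;\Pi\;|\;\Gamma,B\vdash\Delta;\Pi\Rightarrow\Gamma,A\vee_i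 B\vdash\Delta;\Pi$; $\ \Gamma\vdash\Delta;A_j\Rightarrow\Gamma\vdash\Delta;A_1\vee_i A_2$ ($j=1,2$); - $\Gamma,A\to_i B\vdash\Delta;A\;|\;\Gamma,B\vdash\Delta;\Pi\Rightarrow\Gamma,A\to_i B\vdash\Delta;\Pi$; $\ \Gamma,A\vdash\Delta;B\Rightarrow\Gamma\vdash\Delta;A\to_i B$; - $\Gamma,\neg A\vdash\Delta;A\Rightarrow\Gamma,\neg A\vdash\Delta;\cdot$; $\ \Gamma,A\vdash\Delta;\cdot\Rightarrow\Gamma\vdash\Delta,\neg A;\cdot$; $\ \Gamma,\bot\vdash\Delta;\Pi$ (axiom); - $\Gamma,\forall x.A,A[y/x]\vdash\Delta;\Pi\Rightarrow\Gamma,\forall x.A\vdash\Delta;\Pi$; $\ \Gamma\vdash\Delta;A[y/x]\Rightarrow\Gamma\vdash\Delta;\forall x.A\ (*)$; - $\Gamma,A[y/x]\vdash\Delta;\Pi\Rightarrow\Gamma,\exists_i x.A\vdash\Delta;\Pi\ (*)$; $\ \Gamma\vdash\Delta;A[y/x]\Rightarrow\Gamma\vdash\Delta;\exists_i x.A$;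 - $\Gamma,A\vdash\Delta;\cdot\;|\;\Gamma,B\vdash\Delta;\cdot\Rightarrow\Gamma,A\vee_c B\vdash\Delta;\cdot$; $\ \Gamma\vdash A,B,\Delta;\cdot\Rightarrow\Gamma\vdash A\vee_c B,\Delta;\cdot$; - $\Gamma,A\to_c B\vdash\Delta;A\;|\;\Gamma,B\vdash\Delta;\cdot\Rightarrow\Gamma,A\to_c B\vdash\Delta;\cdot$; $\ \Gamma,A\vdash B,\Delta;\cdot\Rightarrow\Gamma\vdash A\to_c B,\Delta;\cdot$; - $\Gamma,p_i\vdash\Delta;\cdot\Rightarrow\Gamma,p_c\vdash\Delta;\cdot$; $\ \Gamma\vdash p_i,\Delta;\cdot\Rightarrow\Gamma\vdash p_c,\Delta;\cdot$; - $\Gamma,A[y/x]\vdash\Delta;\cdot\Rightarrow\Gamma,\exists_c x.A\vdash\Delta;\cdot\ (*)$; $\ \Gamma\vdash A[y/x],\exists_c x.A,\Delta;\cdot\Rightarrow\Gamma\vdash\exists_c x.A,\Delta;\cdot$; - $\Gamma,p_i\vdash\Delta;p_i$ (axiom); $\ \Gamma\vdash P,\Delta;P\Rightarrow\Gamma\vdash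 P,\Delta;\cdot$; $\ \Gamma\vdash N,\Delta;\cdot\Rightarrow\Gamma\vdash\Delta;N$; $\ \Gamma\vdash\Delta;\cdot\Rightarrow\Gamma\vdash\Delta;A$; - ($P$-cut) $\Gamma\vdash\Delta;P\;|\;P,\Gamma\vdash\Delta;\Pi\Rightarrow\Gamma\vdash\Delta;\Pi$; ($N$-cut) $\Gamma\vdash\Delta,N;\Pi^*\;|\;N,\Gamma\vdash\Delta;\Pi\Rightarrow\Gamma\vdash\Delta;\Pi$, where $\Pi^*$ is empty or a positive formula belonging to $\Delta$. **Theorem.** For all finite sets $\Gamma,\Delta$ of formulas and every stoup $\Pi$, the sequent $\Gamma\vdash\Delta;\Pi$ is provable in LCE if and only if $\Gamma,\neg\Delta\vdash\Pi$ is provable in LE, where $\neg\Delta=\{\neg A: A\in\Delta\}$ and the empty stoup is read as $\bot$ on the LE side. -/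

import Mathlib

namespace Ecumenical

universe u

/-- Variable occurrences under `n` binders: free variables are named by natural numbers
(`Sum.inl`), bound variables are de Bruijn indices (`Sum.inr`), `0` being the innermost binder. -/
abbrev Var (n : ℕ) : Type := ℕ ⊕ Fin n

/-- First-order ecumenical formulas (up to renaming of bound variables), with `n` dangling binders.
`P k` is the type of `k`-ary predicate symbols. Every symbol `p` comes in an intuitionistic
version `p_i` and a classical version `p_c`. The language has no function symbols, so that the
only terms are variables. -/
inductive Fml (P : ℕ → Type u) : ℕ → Type u
  /-- `p_i(v)` -/
  | atomI {n k : ℕ} (p : P k) (v : Fin k → Var n) : Fml P n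
  /-- `p_c(v)` -/
  | atomC {n k : ℕ} (p : P k) (v : Fin k → Var n) : Fml P n
  | bot {n : ℕ} : Fml P n
  | neg {n : ℕ} (A : Fml P n) : Fml P n
  | and {n : ℕ} (A B : Fml P n) : Fml P n
  | all {n : ℕ} (A : Fml P (n + 1)) : Fml P n
  | impI {n : ℕ} (A B : Fml P n) : Fml P n
  | orI {n : ℕ} (A B : Fml P n) : Fml P n
  | exI {n : ℕ} (A : Fml P (n + 1)) : Fml P n
  | impC {n : ℕ} (A B : Fml P n) : Fml P n
  | orC {n : ℕ} (A B : Fml P n) : Fml P n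
  | exC {n : ℕ} (A : Fml P (n + 1)) : Fml P n

/-- The formulas of the language: no dangling bound variable (free variables are allowed). -/
abbrev Formula (P : ℕ → Type u) : Type u := Fml P 0

noncomputable instance (P : ℕ → Type u) (n : ℕ) : DecidableEq (Fml P n) := Classical.decEq _

/-- Going under a binder: the variable of the new binder is kept, all other bound variables of
the target are shifted. -/
def Var.lift {m n : ℕ} (σ : Var m → Var n) : Var (m + 1) → Var (n + 1)
  | Sum.inl x => Sum.map id Fin.succ (σ (Sum.inl x))
  | Sum.inr i => Fin.cases (Sum.inr 0) (fun j => Sum.map id Fin.succ (σ (Sum.inr j))) i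

/-- Capture-avoiding replacement of variables by variables. -/
def Fml.rename {P : ℕ → Type u} : {m n : ℕ} → (Var m → Var n) → Fml P m → Fml P n
  | _, _, σ, .atomI p v => .atomI p (fun i => σ (v i))
  | _, _, σ, .atomC p v => .atomC p (fun i => σ (v i))
  | _, _, _, .bot => .bot
  | _, _, σ, .neg A => .neg (A.rename σ)
  | _, _, σ, .and A B => .and (A.rename σ) (B.rename σ)
  | _, _, σ, .all A => .all (A.rename (Var.lift σ))
  | _, _, σ, .impI A B => .impI (A.rename σ) (B.rename σ)
  | _, _, σ, .orI A B => .orI (A.rename σ) (B.rename σ)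
  | _, _, σ, .exI A => .exI (A.rename (Var.lift σ))
  | _, _, σ, .impC A B => .impC (A.rename σ) (B.rename σ)
  | _, _, σ, .orC A B => .orC (A.rename σ) (B.rename σ)
  | _, _, σ, .exC A => .exC (A.rename (Var.lift σ))

/-- `A[y/x]`, where `x` is the variable of the outermost binder from which `A` was stripped. -/
def Fml.inst {P : ℕ → Type u} (A : Fml P 1) (y : ℕ) : Formula P :=
  A.rename (Sum.elim Sum.inl (fun _ => Sum.inl y))

/-- The variable `y` occurs free in the formula. -/
def Fml.FreeIn {P : ℕ → Type u} (y : ℕ) : {n : ℕ} → Fml P n → Prop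
  | _, .atomI _ v => ∃ i, v i = Sum.inl y
  | _, .atomC _ v => ∃ i, v i = Sum.inl y
  | _, .bot => False
  | _, .neg A => A.FreeIn y
  | _, .and A B => A.FreeIn y ∨ B.FreeIn y
  | _, .all A => A.FreeIn y
  | _, .impI A B => A.FreeIn y ∨ B.FreeIn y
  | _, .orI A B => A.FreeIn y ∨ B.FreeIn y
  | _, .exI A => A.FreeIn y
  | _, .impC A B => A.FreeIn y ∨ B.FreeIn y
  | _, .orC A B => A.FreeIn y ∨ B.FreeIn y
  | _, .exC A => A.FreeIn y

/-- A formula is negative if its main connective is classical (classical atoms included) or the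
negation. -/
def Fml.Negative {P : ℕ → Type u} : {n : ℕ} → Fml P n → Prop
  | _, .atomC _ _ => True
  | _, .neg _ => True
  | _, .impC _ _ => True
  | _, .orC _ _ => True
  | _, .exC _ => True
  | _, _ => False

/-- A formula is positive if it is not negative. -/
def Fml.Positive {P : ℕ → Type u} {n : ℕ} (A : Fml P n) : Prop := ¬ A.Negative

open Fml

/-- `LE Γ C`: the sequent `Γ ⊢ C`, with `Γ` a finite multiset, is provable in the ecumenical
sequent calculus LE. -/
inductive LE {P : ℕ → Type u} : Multiset (Formula P) → Formula P → Prop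
  -- intuitionistic and neutral rules
  | andL {Γ : Multiset (Formula P)} {A B C : Formula P} :
      LE (A ::ₘ B ::ₘ Γ) C → LE (and A B ::ₘ Γ) C
  | andR {Γ : Multiset (Formula P)} {A B : Formula P} :
      LE Γ A → LE Γ B → LE Γ (and A B)
  | orIL {Γ : Multiset (Formula P)} {A B C : Formula P} :
      LE (A ::ₘ Γ) C → LE (B ::ₘ Γ) C → LE (orI A B ::ₘ Γ) C
  | orIR₁ {Γ : Multiset (Formula P)} {A B : Formula P} :
      LE Γ A → LE Γ (orI A B)
  | orIR₂ {Γ : Multiset (Formula P)} {A B : Formula P} :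
      LE Γ B → LE Γ (orI A B)
  | impIL {Γ : Multiset (Formula P)} {A B C : Formula P} :
      LE (impI A B ::ₘ Γ) A → LE (B ::ₘ Γ) C → LE (impI A B ::ₘ Γ) C
  | impIR {Γ : Multiset (Formula P)} {A B : Formula P} :
      LE (A ::ₘ Γ) B → LE Γ (impI A B)
  | negL {Γ : Multiset (Formula P)} {A : Formula P} :
      LE (neg A ::ₘ Γ) A → LE (neg A ::ₘ Γ) bot
  | negR {Γ : Multiset (Formula P)} {A : Formula P} :
      LE (A ::ₘ Γ) bot → LE Γ (neg A)
  | botL {Γ : Multiset (Formula P)} {A : Formula P} :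
      LE (bot ::ₘ Γ) A
  | allL {Γ : Multiset (Formula P)} {A : Fml P 1} {C : Formula P} (y : ℕ) :
      LE (A.inst y ::ₘ all A ::ₘ Γ) C → LE (all A ::ₘ Γ) C
  | allR {Γ : Multiset (Formula P)} {A : Fml P 1} (y : ℕ)
      (hΓ : ∀ B ∈ Γ, ¬ B.FreeIn y) (hA : ¬ (all A).FreeIn y) :
      LE Γ (A.inst y) → LE Γ (all A)
  | exIL {Γ : Multiset (Formula P)} {A : Fml P 1} {C : Formula P} (y : ℕ)
      (hΓ : ∀ B ∈ Γ, ¬ B.FreeIn y) (hA : ¬ (exI A).FreeIn y) (hC : ¬ C.FreeIn y) :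
      LE (A.inst y ::ₘ Γ) C → LE (exI A ::ₘ Γ) C
  | exIR {Γ : Multiset (Formula P)} {A : Fml P 1} (y : ℕ) :
      LE Γ (A.inst y) → LE Γ (exI A)
  -- classical rules
  | orCL {Γ : Multiset (Formula P)} {A B : Formula P} :
      LE (A ::ₘ Γ) bot → LE (B ::ₘ Γ) bot → LE (orC A B ::ₘ Γ) bot
  | orCR {Γ : Multiset (Formula P)} {A B : Formula P} :
      LE (neg A ::ₘ neg B ::ₘ Γ) bot → LE Γ (orC A B)
  | impCL {Γ : Multiset (Formula P)} {A B : Formula P} :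
      LE (impC A B ::ₘ Γ) A → LE (B ::ₘ Γ) bot → LE (impC A B ::ₘ Γ) bot
  | impCR {Γ : Multiset (Formula P)} {A B : Formula P} :
      LE (A ::ₘ neg B ::ₘ Γ) bot → LE Γ (impC A B)
  | atomCL {Γ : Multiset (Formula P)} {k : ℕ} {p : P k} {v : Fin k → Var 0} :
      LE (atomI p v ::ₘ Γ) bot → LE (atomC p v ::ₘ Γ) bot
  | atomCR {Γ : Multiset (Formula P)} {k : ℕ} {p : P k} {v : Fin k → Var 0} :
      LE (neg (atomI p v) ::ₘ Γ) bot → LE Γ (atomC p v)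
  | exCL {Γ : Multiset (Formula P)} {A : Fml P 1} (y : ℕ)
      (hΓ : ∀ B ∈ Γ, ¬ B.FreeIn y) (hA : ¬ (exC A).FreeIn y) :
      LE (A.inst y ::ₘ Γ) bot → LE (exC A ::ₘ Γ) bot
  | exCR {Γ : Multiset (Formula P)} {A : Fml P 1} :
      LE (all (neg A) ::ₘ Γ) bot → LE Γ (exC A)
  -- initial, cut and structural rules
  | init {Γ : Multiset (Formula P)} {k : ℕ} {p : P k} {v : Fin k → Var 0} :
      LE (atomI p v ::ₘ Γ) (atomI p v)
  | cut {Γ : Multiset (Formula P)} {A C : Formula P} :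
      LE Γ A → LE (A ::ₘ Γ) C → LE Γ C
  | weak {Γ : Multiset (Formula P)} {A : Formula P} :
      LE Γ bot → LE Γ A

/-- `LCE Γ Δ S`: the stoup sequent `Γ ⊢ Δ; S` is provable in the pure ecumenical sequent calculus
LCE. `Γ` and the classical right context `Δ` are finite sets; the stoup `S` holds at most one
formula (`none` is the empty stoup). -/
inductive LCE {P : ℕ → Type u} :
    Finset (Formula P) → Finset (Formula P) → Option (Formula P) → Prop
  -- intuitionistic and neutral rules
  | andL {Γ Δ : Finset (Formula P)} {S : Option (Formula P)} {A B : Formula P} :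
      LCE (insert A (insert B Γ)) Δ S → LCE (insert (and A B) Γ) Δ S
  | andR {Γ Δ : Finset (Formula P)} {A B : Formula P} :
      LCE Γ Δ (some A) → LCE Γ Δ (some B) → LCE Γ Δ (some (and A B))
  | orIL {Γ Δ : Finset (Formula P)} {S : Option (Formula P)} {A B : Formula P} :
      LCE (insert A Γ) Δ S → LCE (insert B Γ) Δ S → LCE (insert (orI A B) Γ) Δ S
  | orIR₁ {Γ Δ : Finset (Formula P)} {A B : Formula P} :
      LCE Γ Δ (some A) → LCE Γ Δ (some (orI A B))
  | orIR₂ {Γ Δ : Finset (Formula P)} {A B : Formula P} :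
      LCE Γ Δ (some B) → LCE Γ Δ (some (orI A B))
  | impIL {Γ Δ : Finset (Formula P)} {S : Option (Formula P)} {A B : Formula P} :
      LCE (insert (impI A B) Γ) Δ (some A) → LCE (insert B Γ) Δ S →
        LCE (insert (impI A B) Γ) Δ S
  | impIR {Γ Δ : Finset (Formula P)} {A B : Formula P} :
      LCE (insert A Γ) Δ (some B) → LCE Γ Δ (some (impI A B))
  | negL {Γ Δ : Finset (Formula P)} {A : Formula P} :
      LCE (insert (neg A) Γ) Δ (some A) → LCE (insert (neg A) Γ) Δ none
  | negR {Γ Δ : Finset (Formula P)} {A : Formula P} :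
      LCE (insert A Γ) Δ none → LCE Γ (insert (neg A) Δ) none
  | botL {Γ Δ : Finset (Formula P)} {S : Option (Formula P)} :
      LCE (insert bot Γ) Δ S
  | exIL {Γ Δ : Finset (Formula P)} {S : Option (Formula P)} {A : Fml P 1} (y : ℕ)
      (hΓ : ∀ B ∈ Γ, ¬ B.FreeIn y) (hΔ : ∀ B ∈ Δ, ¬ B.FreeIn y)
      (hS : ∀ B ∈ S, ¬ B.FreeIn y) (hA : ¬ (exI A).FreeIn y) :
      LCE (insert (A.inst y) Γ) Δ S → LCE (insert (exI A) Γ) Δ S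
  | exIR {Γ Δ : Finset (Formula P)} {A : Fml P 1} (y : ℕ) :
      LCE Γ Δ (some (A.inst y)) → LCE Γ Δ (some (exI A))
  | allL {Γ Δ : Finset (Formula P)} {S : Option (Formula P)} {A : Fml P 1} (y : ℕ) :
      LCE (insert (all A) (insert (A.inst y) Γ)) Δ S → LCE (insert (all A) Γ) Δ S
  | allR {Γ Δ : Finset (Formula P)} {A : Fml P 1} (y : ℕ)
      (hΓ : ∀ B ∈ Γ, ¬ B.FreeIn y) (hΔ : ∀ B ∈ Δ, ¬ B.FreeIn y) (hA : ¬ (all A).FreeIn y) :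
      LCE Γ Δ (some (A.inst y)) → LCE Γ Δ (some (all A))
  -- classical rules
  | orCL {Γ Δ : Finset (Formula P)} {A B : Formula P} :
      LCE (insert A Γ) Δ none → LCE (insert B Γ) Δ none → LCE (insert (orC A B) Γ) Δ none
  | orCR {Γ Δ : Finset (Formula P)} {A B : Formula P} :
      LCE Γ (insert A (insert B Δ)) none → LCE Γ (insert (orC A B) Δ) none
  | impCL {Γ Δ : Finset (Formula P)} {A B : Formula P} :
      LCE (insert (impC A B) Γ) Δ (some A) → LCE (insert B Γ) Δ none →
        LCE (insert (impC A B) Γ) Δ none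
  | impCR {Γ Δ : Finset (Formula P)} {A B : Formula P} :
      LCE (insert A Γ) (insert B Δ) none → LCE Γ (insert (impC A B) Δ) none
  | atomCL {Γ Δ : Finset (Formula P)} {k : ℕ} {p : P k} {v : Fin k → Var 0} :
      LCE (insert (atomI p v) Γ) Δ none → LCE (insert (atomC p v) Γ) Δ none
  | atomCR {Γ Δ : Finset (Formula P)} {k : ℕ} {p : P k} {v : Fin k → Var 0} :
      LCE Γ (insert (atomI p v) Δ) none → LCE Γ (insert (atomC p v) Δ) none
  | exCL {Γ Δ : Finset (Formula P)} {A : Fml P 1} (y : ℕ)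
      (hΓ : ∀ B ∈ Γ, ¬ B.FreeIn y) (hΔ : ∀ B ∈ Δ, ¬ B.FreeIn y) (hA : ¬ (exC A).FreeIn y) :
      LCE (insert (A.inst y) Γ) Δ none → LCE (insert (exC A) Γ) Δ none
  | exCR {Γ Δ : Finset (Formula P)} {A : Fml P 1} (y : ℕ) :
      LCE Γ (insert (A.inst y) (insert (exC A) Δ)) none → LCE Γ (insert (exC A) Δ) none
  -- initial, decision and structural rules
  | init {Γ Δ : Finset (Formula P)} {k : ℕ} {p : P k} {v : Fin k → Var 0} :
      LCE (insert (atomI p v) Γ) Δ (some (atomI p v))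
  | der {Γ Δ : Finset (Formula P)} {A : Formula P} (hA : A.Positive) :
      LCE Γ (insert A Δ) (some A) → LCE Γ (insert A Δ) none
  | store {Γ Δ : Finset (Formula P)} {A : Formula P} (hA : A.Negative) :
      LCE Γ (insert A Δ) none → LCE Γ Δ (some A)
  | weak {Γ Δ : Finset (Formula P)} {A : Formula P} :
      LCE Γ Δ none → LCE Γ Δ (some A)
  -- cut rules
  | cutP {Γ Δ : Finset (Formula P)} {S : Option (Formula P)} {A : Formula P} (hA : A.Positive) :
      LCE Γ Δ (some A) → LCE (insert A Γ) Δ S → LCE Γ Δ S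
  | cutN {Γ Δ : Finset (Formula P)} {S S' : Option (Formula P)} {A : Formula P} (hA : A.Negative)
      (hS' : S' = none ∨ ∃ B ∈ Δ, B.Positive ∧ S' = some B) :
      LCE Γ (insert A Δ) S' → LCE (insert A Γ) Δ S → LCE Γ Δ S

end Ecumenical

/-! A formula in the classical context of LCE behaves like its negation on the left, and an empty
stoup behaves like ⊥. Both directions are inductions on derivations.

From LCE to LE (`LCE.toLE`), acting on a formula A of Δ amounts to applying the left rule for ¬A: it
trades the goal ⊥ for the goal A while ¬A stays available, and the right rule of LE for A can then
be used. The rule `store` and the N-cut need that a negative formula follows in LE from the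
refutation of its negation (`LE.by_contra`). This is what the notion of negativity provides.

From LE to LCE (`LE.toLCE`), a derivation of Γ ⊢ C becomes one of Γ ⊢ ∅; C. Two obstacles are
removed by cuts: the cut of LE is unrestricted (`LCE.cut`), and classical right rules of LE put
negations on the left where LCE puts formulas in the classical context (`LCE.of_neg`). The same
device finally moves ¬Δ back to Δ.

Both inductions compare contexts only by membership. This rests on identity sequents for all
formulas and on weakening and contraction (`LE.mono`, `LCE.mono`), whose proofs must rename
eigenvariables. -/

namespace Ecumenical

open Fml

universe u

variable {P : ℕ → Type u}

/-! ### Renaming and fresh variables -/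

@[simp] theorem Var.lift_inl {m n : ℕ} (σ : Var m → Var n) (x : ℕ) :
    Var.lift σ (Sum.inl x) = Sum.map id Fin.succ (σ (Sum.inl x)) := rfl

@[simp] theorem Var.lift_inr_zero {m n : ℕ} (σ : Var m → Var n) :
    Var.lift σ (Sum.inr 0) = Sum.inr 0 := rfl

@[simp] theorem Var.lift_inr_succ {m n : ℕ} (σ : Var m → Var n) (i : Fin m) :
    Var.lift σ (Sum.inr i.succ) = Sum.map id Fin.succ (σ (Sum.inr i)) := rfl

theorem Var.lift_comp {l m n : ℕ} (σ : Var m → Var n) (τ : Var l → Var m) :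
    Var.lift (σ ∘ τ) = Var.lift σ ∘ Var.lift τ := by
  funext x
  have key : ∀ w : Var m, Sum.map id Fin.succ (σ w) = Var.lift σ (Sum.map id Fin.succ w) := by
    rintro (w | w) <;> simp
  rcases x with x | i
  · simp [key]
  · refine Fin.cases ?_ (fun j => ?_) i
    · simp
    · simp [key]

/-- Names and de Bruijn indices live in separate summands, so substituting names passes under
binders with no risk of capture. -/
theorem Var.lift_map {n : ℕ} (σ : ℕ → ℕ) :
    Var.lift (Sum.map σ id : Var n → Var n) = Sum.map σ id := by
  funext x
  rcases x with x | i
  · simp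
  · refine Fin.cases ?_ (fun j => ?_) i <;> simp

theorem Fml.rename_rename {l : ℕ} (A : Fml P l) : ∀ {m n : ℕ} (σ : Var m → Var n)
    (τ : Var l → Var m), (A.rename τ).rename σ = A.rename (σ ∘ τ) := by
  induction A <;> intros <;> simp only [Fml.rename, Var.lift_comp, Function.comp_apply, *]

/-- Needed for eigenvariables: through `Fml.sub_update`, a substitution may be changed at a variable
not free in the formula. -/
theorem Fml.rename_congr {m : ℕ} (A : Fml P m) : ∀ {n : ℕ} {σ τ : Var m → Var n},
    (∀ y, A.FreeIn y → σ (Sum.inl y) = τ (Sum.inl y)) →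
    (∀ i, σ (Sum.inr i) = τ (Sum.inr i)) → A.rename σ = A.rename τ := by
  have lift_inr : ∀ {m n : ℕ} {σ τ : Var m → Var n}, (∀ i, σ (Sum.inr i) = τ (Sum.inr i)) →
      ∀ i, Var.lift σ (Sum.inr i) = Var.lift τ (Sum.inr i) := by
    intro m n σ τ h i
    refine Fin.cases ?_ (fun j => ?_) i <;> simp [h]
  have atom : ∀ {m n k : ℕ} {σ τ : Var m → Var n} (v : Fin k → Var m),
      (∀ y, (∃ i, v i = Sum.inl y) → σ (Sum.inl y) = τ (Sum.inl y)) →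
      (∀ i, σ (Sum.inr i) = τ (Sum.inr i)) → (fun i => σ (v i)) = fun i => τ (v i) := by
    intro m n k σ τ v h₁ h₂
    funext i
    rcases hv : v i with y | j
    · exact h₁ y ⟨i, hv⟩
    · exact h₂ j
  induction A with
  | atomI p v => intro n σ τ h₁ h₂; simp only [Fml.rename, atom v h₁ h₂]
  | atomC p v => intro n σ τ h₁ h₂; simp only [Fml.rename, atom v h₁ h₂]
  | bot => intros; rfl
  | neg A ih => intro n σ τ h₁ h₂; simp only [Fml.rename, ih h₁ h₂]
  | all A ih | exI A ih | exC A ih =>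
    intro n σ τ h₁ h₂
    simp only [Fml.rename]
    rw [ih (fun y hy => by simp [h₁ y hy]) (lift_inr h₂)]
  | and A B ihA ihB | impI A B ihA ihB | orI A B ihA ihB | impC A B ihA ihB | orC A B ihA ihB =>
    intro n σ τ h₁ h₂
    simp only [Fml.rename]
    rw [ihA (fun y hy => h₁ y (Or.inl hy)) h₂, ihB (fun y hy => h₁ y (Or.inr hy)) h₂]

theorem Var.lift_id {n : ℕ} : Var.lift (id : Var n → Var n) = id := by
  simpa using Var.lift_map (n := n) id

theorem Fml.rename_id {n : ℕ} (A : Fml P n) : A.rename id = A := by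
  induction A <;> simp_all [Fml.rename, Var.lift_id]

/-- Replacement of the free variables according to `σ`. -/
def Fml.sub {n : ℕ} (σ : ℕ → ℕ) (A : Fml P n) : Fml P n := A.rename (Sum.map σ id)

theorem Fml.sub_id {n : ℕ} (A : Fml P n) : A.sub id = A := by
  simp [Fml.sub, Fml.rename_id]

section sub
variable {n : ℕ} (σ : ℕ → ℕ)

@[simp] theorem Fml.sub_neg (A : Fml P n) : (neg A).sub σ = neg (A.sub σ) := rfl
@[simp] theorem Fml.sub_all (A : Fml P (n + 1)) : (all A).sub σ = all (A.sub σ) := by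
  simp [Fml.sub, Fml.rename, Var.lift_map]
@[simp] theorem Fml.sub_exI (A : Fml P (n + 1)) : (exI A).sub σ = exI (A.sub σ) := by
  simp [Fml.sub, Fml.rename, Var.lift_map]
@[simp] theorem Fml.sub_exC (A : Fml P (n + 1)) : (exC A).sub σ = exC (A.sub σ) := by
  simp [Fml.sub, Fml.rename, Var.lift_map]

end sub

theorem Fml.sub_inst (σ : ℕ → ℕ) (A : Fml P 1) (y : ℕ) :
    (A.inst y).sub σ = (A.sub σ).inst (σ y) := by
  simp only [Fml.sub, Fml.inst, Fml.rename_rename]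
  congr 1
  funext x
  rcases x with x | x <;> simp

theorem Fml.sub_update {n : ℕ} (σ : ℕ → ℕ) {A : Fml P n} {y : ℕ} (hy : ¬ A.FreeIn y) (z : ℕ) :
    A.sub (Function.update σ y z) = A.sub σ := by
  refine A.rename_congr (fun x hx => ?_) (fun i => rfl)
  have : x ≠ y := fun h => hy (h ▸ hx)
  simp [this]

/-- Replaces the eigenvariable y of a premise by z. The side formulas do not see the change, by
`Fml.sub_update`. -/
theorem Fml.sub_update_inst (σ : ℕ → ℕ) {A : Fml P 1} {y : ℕ} (hy : ¬ A.FreeIn y) (z : ℕ) :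
    (A.inst y).sub (Function.update σ y z) = (A.sub σ).inst z := by
  rw [Fml.sub_inst, Fml.sub_update σ hy, Function.update_self]

theorem Fml.negative_sub {n : ℕ} (σ : ℕ → ℕ) (A : Fml P n) :
    (A.sub σ).Negative ↔ A.Negative := by
  cases A <;> rfl

theorem Fml.positive_sub {n : ℕ} (σ : ℕ → ℕ) (A : Fml P n) :
    (A.sub σ).Positive ↔ A.Positive := not_congr (A.negative_sub σ)

theorem Fml.finite_freeIn {n : ℕ} (A : Fml P n) : {y | A.FreeIn y}.Finite := by
  have atom : ∀ {n k : ℕ} (v : Fin k → Var n), {y : ℕ | ∃ i, v i = Sum.inl y}.Finite := by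
    intro n k v
    -- The value 0 given to bound variables is a dummy: the range only has to contain the free ones.
    refine Set.Finite.subset
      (Set.finite_range (fun i => Sum.elim (id : ℕ → ℕ) (fun _ => 0) (v i))) ?_
    rintro y ⟨i, hi⟩
    exact ⟨i, by simp [hi]⟩
  induction A with
  | atomI p v | atomC p v => exact atom v
  | bot => simp [Fml.FreeIn]
  | neg A ih | all A ih | exI A ih | exC A ih => exact ih
  | and A B ihA ihB | impI A B ihA ihB | orI A B ihA ihB | impC A B ihA ihB | orC A B ihA ihB =>
    exact ihA.union ihB

theorem exists_fresh (s : Finset (Formula P)) : ∃ y, ∀ A ∈ s, ¬ A.FreeIn y := by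
  have h : (⋃ A ∈ s, {y | A.FreeIn y}).Finite :=
    s.finite_toSet.biUnion fun A _ => A.finite_freeIn
  obtain ⟨y, hy⟩ := h.exists_notMem
  exact ⟨y, fun A hA hf => hy (Set.mem_biUnion hA hf)⟩

/-! ### Structural properties of LE -/

section LE
variable {Γ Θ : Multiset (Formula P)} {A C : Formula P}

/-- Identity sequents in LE, for all instances of `A`, so that the induction goes through
binders. -/
theorem LE.identity_rename {n : ℕ} (A : Fml P n) : ∀ (σ : Var n → Var 0)
    (Γ : Multiset (Formula P)), LE (A.rename σ ::ₘ Γ) (A.rename σ) := by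
  induction A with
  | atomI p v => exact fun σ Γ => LE.init
  | atomC p v =>
    refine fun σ Γ => LE.atomCR ?_
    rw [Multiset.cons_swap]
    refine LE.atomCL ?_
    rw [Multiset.cons_swap]
    exact LE.negL (by rw [Multiset.cons_swap]; exact LE.init)
  | bot => exact fun σ Γ => LE.botL
  | neg A ih =>
    refine fun σ Γ => LE.negR ?_
    rw [Multiset.cons_swap]
    exact LE.negL (by rw [Multiset.cons_swap]; exact ih _ _)
  | and A B ihA ihB =>
    exact fun σ Γ => LE.andR (LE.andL (ihA _ _))
      (LE.andL (by rw [Multiset.cons_swap]; exact ihB _ _))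
  | impI A B ihA ihB =>
    refine fun σ Γ => LE.impIR ?_
    rw [Multiset.cons_swap]
    exact LE.impIL (by rw [Multiset.cons_swap]; exact ihA _ _) (ihB _ _)
  | orI A B ihA ihB =>
    exact fun σ Γ => LE.orIL (LE.orIR₁ (ihA _ _)) (LE.orIR₂ (ihB _ _))
  | impC A B ihA ihB =>
    refine fun σ Γ => LE.impCR ?_
    rw [Multiset.cons_swap (B.rename σ).neg, Multiset.cons_swap]
    refine LE.impCL (by rw [Multiset.cons_swap]; exact ihA _ _) ?_
    rw [Multiset.cons_swap (A.rename σ), Multiset.cons_swap]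
    exact LE.negL (by rw [Multiset.cons_swap]; exact ihB _ _)
  | orC A B ihA ihB =>
    refine fun σ Γ => LE.orCR ?_
    rw [Multiset.cons_swap (B.rename σ).neg, Multiset.cons_swap]
    refine LE.orCL ?_ ?_
    · rw [Multiset.cons_swap]
      exact LE.negL (by rw [Multiset.cons_swap]; exact ihA _ _)
    · rw [Multiset.cons_swap (A.rename σ).neg, Multiset.cons_swap]
      exact LE.negL (by rw [Multiset.cons_swap]; exact ihB _ _)
  | all A ih =>
    intro σ Γ
    obtain ⟨y, hy⟩ := exists_fresh (insert ((all A).rename σ) Γ.toFinset)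
    refine LE.allR y (fun B hB => hy B (by simpa using hB)) (hy _ (Finset.mem_insert_self _ _))
      (LE.allL y ?_)
    simp only [Fml.inst, Fml.rename_rename]
    exact ih _ _
  | exI A ih =>
    intro σ Γ
    obtain ⟨y, hy⟩ := exists_fresh (insert ((exI A).rename σ) Γ.toFinset)
    refine LE.exIL y (fun B hB => hy B (by simp [hB])) (hy _ (Finset.mem_insert_self _ _))
      (hy _ (by simp)) (LE.exIR y ?_)
    simp only [Fml.inst, Fml.rename_rename]
    exact ih _ _
  | exC A ih =>
    intro σ Γ
    obtain ⟨y, hy⟩ := exists_fresh (insert ((exC A).rename σ) Γ.toFinset)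
    refine LE.exCR ?_
    rw [Multiset.cons_swap]
    have hA := hy _ (Finset.mem_insert_self _ _)
    refine LE.exCL y (fun B hB => ?_) hA ?_
    · rcases Multiset.mem_cons.1 hB with rfl | hB
      · exact hA
      · exact hy B (by simp [hB])
    · rw [Multiset.cons_swap]
      -- Instantiating ∀¬A at the eigenvariable of ∃_c gives the negation of the very formula
      -- assumed.
      refine LE.allL y (LE.negL ?_)
      simp only [Fml.inst, Fml.rename_rename]
      rw [Multiset.cons_swap (Fml.all _), Multiset.cons_swap (Fml.neg _)]
      exact ih _ _

theorem LE.of_mem (h : A ∈ Γ) : LE Γ A := by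
  obtain ⟨Γ, rfl⟩ := Multiset.exists_cons_of_mem h
  simpa only [Fml.rename_id] using LE.identity_rename A id Γ

/-- Contraction is a cut against an identity sequent. -/
theorem LE.contract (hA : A ∈ Γ) (h : LE (A ::ₘ Γ) C) : LE Γ C := LE.cut (LE.of_mem hA) h

theorem LE.negL_mem (hA : neg A ∈ Γ) (h : LE Γ A) : LE Γ bot := by
  obtain ⟨Γ, rfl⟩ := Multiset.exists_cons_of_mem hA
  exact LE.negL h

theorem LE.allL_mem {A : Fml P 1} (hA : all A ∈ Γ) (y : ℕ) (h : LE (A.inst y ::ₘ Γ) C) :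
    LE Γ C := by
  obtain ⟨Γ, rfl⟩ := Multiset.exists_cons_of_mem hA
  exact LE.allL y h

/-- Weakening, contraction and substitution are proved together: an eigenvariable may occur in the
new context Θ, so the induction has to be able to rename it. Only membership in Θ is required, since
σ may identify formulas; a left rule that consumes its principal formula is applied to an extra
copy, supplied by `LE.contract`. -/
theorem LE.mono_sub (h : LE Γ C) : ∀ (σ : ℕ → ℕ) (Θ : Multiset (Formula P)),
    (∀ A ∈ Γ, A.sub σ ∈ Θ) → LE Θ (C.sub σ) := by
  have cons : ∀ {Γ Θ : Multiset (Formula P)} {A : Formula P} {σ : ℕ → ℕ},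
      (∀ B ∈ Γ, B.sub σ ∈ Θ) → ∀ B ∈ A ::ₘ Γ, B.sub σ ∈ A.sub σ ::ₘ Θ := by
    intro Γ Θ A σ h B hB
    rcases Multiset.mem_cons.1 hB with rfl | hB
    · exact Multiset.mem_cons_self _ _
    · exact Multiset.mem_cons_of_mem (h B hB)
  have weak : ∀ {Γ Θ : Multiset (Formula P)} {A : Formula P} {σ : ℕ → ℕ},
      (∀ B ∈ Γ, B.sub σ ∈ Θ) → ∀ B ∈ Γ, B.sub σ ∈ A ::ₘ Θ :=
    fun h B hB => Multiset.mem_cons_of_mem (h B hB)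
  have upd : ∀ {Γ Θ : Multiset (Formula P)} {σ : ℕ → ℕ} {y z : ℕ}, (∀ B ∈ Γ, ¬ B.FreeIn y) →
      (∀ B ∈ Γ, B.sub σ ∈ Θ) → ∀ B ∈ Γ, B.sub (Function.update σ y z) ∈ Θ := by
    intro Γ Θ σ y z hy h B hB
    rw [Fml.sub_update σ (hy B hB)]
    exact h B hB
  induction h with
  | andL _ ih =>
    intro σ Θ hΘ
    obtain ⟨hA, hΘ'⟩ := Multiset.forall_mem_cons.1 hΘ
    exact LE.contract hA (LE.andL (ih σ _ (cons (cons hΘ'))))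
  | andR _ _ ih₁ ih₂ => exact fun σ Θ hΘ => LE.andR (ih₁ σ Θ hΘ) (ih₂ σ Θ hΘ)
  | orIL _ _ ih₁ ih₂ =>
    intro σ Θ hΘ
    obtain ⟨hA, hΘ'⟩ := Multiset.forall_mem_cons.1 hΘ
    exact LE.contract hA (LE.orIL (ih₁ σ _ (cons hΘ')) (ih₂ σ _ (cons hΘ')))
  | orIR₁ _ ih => exact fun σ Θ hΘ => LE.orIR₁ (ih σ Θ hΘ)
  | orIR₂ _ ih => exact fun σ Θ hΘ => LE.orIR₂ (ih σ Θ hΘ)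
  | impIL _ _ ih₁ ih₂ =>
    intro σ Θ hΘ
    obtain ⟨hA, hΘ'⟩ := Multiset.forall_mem_cons.1 hΘ
    exact LE.contract hA (LE.impIL (ih₁ σ _ (weak hΘ)) (ih₂ σ _ (cons hΘ')))
  | impIR _ ih => exact fun σ Θ hΘ => LE.impIR (ih σ _ (cons hΘ))
  | negL _ ih => exact fun σ Θ hΘ => LE.negL_mem (hΘ _ (Multiset.mem_cons_self _ _)) (ih σ Θ hΘ)
  | negR _ ih => exact fun σ Θ hΘ => LE.negR (ih σ _ (cons hΘ))
  | botL => exact fun σ Θ hΘ => LE.contract (hΘ _ (Multiset.mem_cons_self _ _)) LE.botL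
  | allL y _ ih =>
    intro σ Θ hΘ
    have hA := hΘ _ (Multiset.mem_cons_self _ _)
    rw [Fml.sub_all] at hA
    refine LE.allL_mem hA (σ y) ?_
    rw [← Fml.sub_inst]
    exact ih σ _ (cons hΘ)
  | @allR Γ A y hΓ hA _ ih =>
    intro σ Θ hΘ
    obtain ⟨z, hz⟩ := exists_fresh (insert ((all A).sub σ) Θ.toFinset)
    rw [Fml.sub_all] at hz ⊢
    refine LE.allR z (fun B hB => hz B (by simp [hB])) (hz _ (Finset.mem_insert_self _ _)) ?_
    -- The eigenvariable y is redirected to the fresh z; y is not free in Γ, so the context is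
    -- unaffected.
    rw [← Fml.sub_update_inst σ hA z]
    exact ih _ _ (upd hΓ hΘ)
  | @exIL Γ A C y hΓ hA hC _ ih =>
    intro σ Θ hΘ
    obtain ⟨hA', hΘ'⟩ := Multiset.forall_mem_cons.1 hΘ
    obtain ⟨z, hz⟩ := exists_fresh (insert (C.sub σ) Θ.toFinset)
    rw [Fml.sub_exI] at hA'
    refine LE.contract hA' (LE.exIL z (fun B hB => hz B (by simp [hB])) (hz _ (by simp [hA']))
      (hz _ (Finset.mem_insert_self _ _)) ?_)
    rw [← Fml.sub_update_inst σ hA z, ← Fml.sub_update σ hC z]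
    exact ih _ _ (cons (upd hΓ hΘ'))
  | exIR y _ ih =>
    intro σ Θ hΘ
    rw [Fml.sub_exI]
    refine LE.exIR (σ y) ?_
    rw [← Fml.sub_inst]
    exact ih σ Θ hΘ
  | orCL _ _ ih₁ ih₂ =>
    intro σ Θ hΘ
    obtain ⟨hA, hΘ'⟩ := Multiset.forall_mem_cons.1 hΘ
    exact LE.contract hA (LE.orCL (ih₁ σ _ (cons hΘ')) (ih₂ σ _ (cons hΘ')))
  | orCR _ ih => exact fun σ Θ hΘ => LE.orCR (ih σ _ (cons (cons hΘ)))
  | impCL _ _ ih₁ ih₂ =>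
    intro σ Θ hΘ
    obtain ⟨hA, hΘ'⟩ := Multiset.forall_mem_cons.1 hΘ
    exact LE.contract hA (LE.impCL (ih₁ σ _ (weak hΘ)) (ih₂ σ _ (cons hΘ')))
  | impCR _ ih => exact fun σ Θ hΘ => LE.impCR (ih σ _ (cons (cons hΘ)))
  | atomCL _ ih =>
    intro σ Θ hΘ
    obtain ⟨hA, hΘ'⟩ := Multiset.forall_mem_cons.1 hΘ
    exact LE.contract hA (LE.atomCL (ih σ _ (cons hΘ')))
  | atomCR _ ih => exact fun σ Θ hΘ => LE.atomCR (ih σ _ (cons hΘ))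
  | @exCL Γ A y hΓ hA _ ih =>
    intro σ Θ hΘ
    obtain ⟨hA', hΘ'⟩ := Multiset.forall_mem_cons.1 hΘ
    obtain ⟨z, hz⟩ := exists_fresh Θ.toFinset
    rw [Fml.sub_exC] at hA'
    refine LE.contract hA' (LE.exCL z (fun B hB => hz B (by simp [hB])) (hz _ (by simp [hA'])) ?_)
    rw [← Fml.sub_update_inst σ hA z]
    exact ih _ _ (cons (upd hΓ hΘ'))
  | @exCR Γ A _ ih =>
    intro σ Θ hΘ
    rw [Fml.sub_exC]
    have := ih σ _ (cons hΘ)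
    rw [Fml.sub_all, Fml.sub_neg] at this
    exact LE.exCR this
  | init => exact fun σ Θ hΘ => LE.of_mem (hΘ _ (Multiset.mem_cons_self _ _))
  | cut _ _ ih₁ ih₂ => exact fun σ Θ hΘ => LE.cut (ih₁ σ Θ hΘ) (ih₂ σ _ (cons hΘ))
  | weak _ ih => exact fun σ Θ hΘ => LE.weak (ih σ Θ hΘ)

theorem LE.mono (h : LE Γ C) (hΘ : ∀ A ∈ Γ, A ∈ Θ) : LE Θ C := by
  simpa only [Fml.sub_id] using h.mono_sub id Θ (by simpa only [Fml.sub_id] using hΘ)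

/-- In LE, negative formulas can be proved by contradiction. -/
theorem LE.by_contra (hA : A.Negative) (h : LE (neg A ::ₘ Γ) bot) : LE Γ A := by
  -- The right rule for A leaves ⊥ to be proved with new hypotheses on the left. By `h` it suffices
  -- to refute A there, which its left rule does against those hypotheses.
  have cut : ∀ {Θ : Multiset (Formula P)}, (∀ B ∈ Γ, B ∈ Θ) → LE (A ::ₘ Θ) bot → LE Θ bot := by
    refine fun hΘ h' => LE.cut (LE.negR h') (h.mono ?_)
    intro B hB
    rcases Multiset.mem_cons.1 hB with rfl | hB
    · exact Multiset.mem_cons_self _ _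
    · exact Multiset.mem_cons_of_mem (hΘ B hB)
  cases A with
  | atomC p v =>
    refine LE.atomCR (cut (by simp +contextual) (LE.atomCL ?_))
    exact LE.negL_mem (A := atomI p v) (by simp) (LE.of_mem (by simp))
  | neg A =>
    refine LE.negR (cut (by simp +contextual) ?_)
    exact LE.negL_mem (A := A) (by simp) (LE.of_mem (by simp))
  | orC A B =>
    refine LE.orCR (cut (by simp +contextual) (LE.orCL ?_ ?_))
    · exact LE.negL_mem (A := A) (by simp) (LE.of_mem (by simp))
    · exact LE.negL_mem (A := B) (by simp) (LE.of_mem (by simp))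
  | impC A B =>
    refine LE.impCR (cut (by simp +contextual) (LE.impCL (LE.of_mem (by simp)) ?_))
    exact LE.negL_mem (A := B) (by simp) (LE.of_mem (by simp))
  | exC A =>
    obtain ⟨y, hy⟩ := exists_fresh (insert (exC A) Γ.toFinset)
    have hA := hy _ (Finset.mem_insert_self _ _)
    refine LE.exCR (cut (by simp +contextual) (LE.exCL y ?_ hA ?_))
    · intro B hB
      rcases Multiset.mem_cons.1 hB with rfl | hB
      · exact hA
      · exact hy B (by simp [hB])
    · refine LE.allL_mem (A := neg A) (by simp) y ?_
      exact LE.negL_mem (A := A.inst y) (by simp [Fml.inst, Fml.rename]) (LE.of_mem (by simp))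
  | _ => exact hA.elim

end LE
/-! ### Structural properties of LCE -/

section LCE
variable {Γ Δ Θ Λ : Finset (Formula P)} {S : Option (Formula P)} {A : Formula P}

theorem LCE.contractL (hA : A ∈ Γ) (h : LCE (insert A Γ) Δ S) : LCE Γ Δ S := by
  rwa [Finset.insert_eq_of_mem hA] at h

theorem LCE.contractR (hA : A ∈ Δ) (h : LCE Γ (insert A Δ) S) : LCE Γ Δ S := by
  rwa [Finset.insert_eq_of_mem hA] at h

/-- Identity sequents in LCE, with the succedent in the stoup and in the classical context. -/
theorem LCE.identity_rename {n : ℕ} (A : Fml P n) : ∀ (σ : Var n → Var 0)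
    (Γ Δ : Finset (Formula P)), LCE (insert (A.rename σ) Γ) Δ (some (A.rename σ)) ∧
      LCE (insert (A.rename σ) Γ) (insert (A.rename σ) Δ) none := by
  -- Positive formulas are decomposed in the stoup and reach the context by `der`; negative ones are
  -- decomposed in the context and reach the stoup by `store`. Both forms are needed at once: for A
  -- →_c B, the first is used for A and the second for B.
  have pos : ∀ {A : Formula P}, A.Positive →
      (∀ Γ Δ : Finset (Formula P), LCE (insert A Γ) Δ (some A)) →
      ∀ Γ Δ : Finset (Formula P),
        LCE (insert A Γ) Δ (some A) ∧ LCE (insert A Γ) (insert A Δ) none :=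
    fun hA h Γ Δ => ⟨h _ _, LCE.der hA (h _ _)⟩
  have neg : ∀ {A : Formula P}, A.Negative →
      (∀ Γ Δ : Finset (Formula P), LCE (insert A Γ) (insert A Δ) none) →
      ∀ Γ Δ : Finset (Formula P),
        LCE (insert A Γ) Δ (some A) ∧ LCE (insert A Γ) (insert A Δ) none :=
    fun hA h Γ Δ => ⟨LCE.store hA (h _ _), h _ _⟩
  induction A with
  | atomI p v => exact fun σ => pos not_false fun Γ Δ => LCE.init
  | atomC p v =>
    exact fun σ => neg trivial fun Γ Δ => LCE.atomCL (LCE.atomCR (LCE.der not_false LCE.init))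
  | bot => exact fun σ => pos not_false fun Γ Δ => LCE.botL
  | neg A ih =>
    refine fun σ => neg trivial fun Γ Δ => LCE.negR ?_
    rw [Finset.insert_comm]
    refine LCE.negL ?_
    rw [Finset.insert_comm]
    exact (ih _ _ _).1
  | and A B ihA ihB =>
    refine fun σ => pos not_false fun Γ Δ => LCE.andL (LCE.andR (ihA _ _ _).1 ?_)
    rw [Finset.insert_comm]
    exact (ihB _ _ _).1
  | impI A B ihA ihB =>
    refine fun σ => pos not_false fun Γ Δ => LCE.impIR ?_
    rw [Finset.insert_comm]
    refine LCE.impIL ?_ (ihB _ _ _).1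
    rw [Finset.insert_comm]
    exact (ihA _ _ _).1
  | orI A B ihA ihB =>
    exact fun σ => pos not_false fun Γ Δ =>
      LCE.orIL (LCE.orIR₁ (ihA _ _ _).1) (LCE.orIR₂ (ihB _ _ _).1)
  | impC A B ihA ihB =>
    refine fun σ => neg trivial fun Γ Δ => LCE.impCR ?_
    rw [Finset.insert_comm]
    refine LCE.impCL ?_ (ihB _ _ _).2
    rw [Finset.insert_comm]
    exact (ihA _ _ _).1
  | orC A B ihA ihB =>
    refine fun σ => neg trivial fun Γ Δ => LCE.orCR (LCE.orCL (ihA _ _ _).2 ?_)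
    rw [Finset.insert_comm (A.rename σ)]
    exact (ihB _ _ _).2
  | all A ih =>
    refine fun σ => pos not_false fun Γ Δ => ?_
    obtain ⟨y, hy⟩ := exists_fresh (insert ((all A).rename σ) Γ ∪ Δ)
    refine LCE.allR y (fun B hB => hy B (Finset.mem_union_left _ hB))
      (fun B hB => hy B (Finset.mem_union_right _ hB)) (hy _ (by simp [Fml.rename]))
      (LCE.allL y ?_)
    rw [Finset.insert_comm]
    simp only [Fml.inst, Fml.rename_rename]
    exact (ih _ _ _).1
  | exI A ih =>
    refine fun σ => pos not_false fun Γ Δ => ?_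
    obtain ⟨y, hy⟩ := exists_fresh (insert ((exI A).rename σ) Γ ∪ Δ)
    have hA : ¬ ((exI A).rename σ).FreeIn y := hy _ (by simp)
    refine LCE.exIL y (fun B hB => hy B (by simp [hB]))
      (fun B hB => hy B (Finset.mem_union_right _ hB)) (by simpa using hA) hA (LCE.exIR y ?_)
    simp only [Fml.inst, Fml.rename_rename]
    exact (ih _ _ _).1
  | exC A ih =>
    refine fun σ => neg trivial fun Γ Δ => ?_
    obtain ⟨y, hy⟩ := exists_fresh (insert ((exC A).rename σ) Γ ∪ Δ)
    have hA : ¬ ((exC A).rename σ).FreeIn y := hy _ (by simp)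
    refine LCE.exCL y (fun B hB => hy B (by simp [hB])) (fun B hB => ?_) hA (LCE.exCR y ?_)
    · rcases Finset.mem_insert.1 hB with rfl | hB
      · exact hA
      · exact hy B (Finset.mem_union_right _ hB)
    · simp only [Fml.inst, Fml.rename_rename]
      exact (ih _ _ _).2

theorem LCE.of_mem (h : A ∈ Γ) : LCE Γ Δ (some A) :=
  LCE.contractL h (by simpa only [Fml.rename_id] using (LCE.identity_rename A id Γ Δ).1)

theorem LCE.of_mem_of_mem (h : A ∈ Γ) (h' : A ∈ Δ) : LCE Γ Δ none :=
  LCE.contractL h (LCE.contractR h'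
    (by simpa only [Fml.rename_id] using (LCE.identity_rename A id Γ Δ).2))

/-- As in LE, substitution is included to rename eigenvariables, but contraction is free because
contexts are sets. Polarity depends only on the main connective, so the side conditions survive σ.
-/
theorem LCE.mono_sub (h : LCE Γ Δ S) : ∀ (σ : ℕ → ℕ) (Θ Λ : Finset (Formula P)),
    (∀ A ∈ Γ, A.sub σ ∈ Θ) → (∀ A ∈ Δ, A.sub σ ∈ Λ) → LCE Θ Λ (S.map (Fml.sub σ)) := by
  have cons : ∀ {Γ Θ : Finset (Formula P)} {A : Formula P} {σ : ℕ → ℕ},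
      (∀ B ∈ Γ, B.sub σ ∈ Θ) → ∀ B ∈ insert A Γ, B.sub σ ∈ insert (A.sub σ) Θ := by
    intro Γ Θ A σ h B hB
    rcases Finset.mem_insert.1 hB with rfl | hB
    · exact Finset.mem_insert_self _ _
    · exact Finset.mem_insert_of_mem (h B hB)
  have weak : ∀ {Γ Θ : Finset (Formula P)} {A : Formula P} {σ : ℕ → ℕ},
      (∀ B ∈ Γ, B.sub σ ∈ Θ) → ∀ B ∈ Γ, B.sub σ ∈ insert A Θ :=
    fun h B hB => Finset.mem_insert_of_mem (h B hB)
  have upd : ∀ {Γ Θ : Finset (Formula P)} {σ : ℕ → ℕ} {y z : ℕ}, (∀ B ∈ Γ, ¬ B.FreeIn y) →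
      (∀ B ∈ Γ, B.sub σ ∈ Θ) → ∀ B ∈ Γ, B.sub (Function.update σ y z) ∈ Θ := by
    intro Γ Θ σ y z hy h B hB
    rw [Fml.sub_update σ (hy B hB)]
    exact h B hB
  induction h with
  | andL _ ih =>
    intro σ Θ Λ hΘ hΛ
    obtain ⟨hA, hΘ'⟩ := (Finset.forall_mem_insert ..).1 hΘ
    exact LCE.contractL hA (LCE.andL (ih σ _ _ (cons (cons hΘ')) hΛ))
  | andR _ _ ih₁ ih₂ =>
    exact fun σ Θ Λ hΘ hΛ => LCE.andR (ih₁ σ Θ Λ hΘ hΛ) (ih₂ σ Θ Λ hΘ hΛ)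
  | orIL _ _ ih₁ ih₂ =>
    intro σ Θ Λ hΘ hΛ
    obtain ⟨hA, hΘ'⟩ := (Finset.forall_mem_insert ..).1 hΘ
    exact LCE.contractL hA (LCE.orIL (ih₁ σ _ _ (cons hΘ') hΛ) (ih₂ σ _ _ (cons hΘ') hΛ))
  | orIR₁ _ ih => exact fun σ Θ Λ hΘ hΛ => LCE.orIR₁ (ih σ Θ Λ hΘ hΛ)
  | orIR₂ _ ih => exact fun σ Θ Λ hΘ hΛ => LCE.orIR₂ (ih σ Θ Λ hΘ hΛ)
  | impIL _ _ ih₁ ih₂ =>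
    intro σ Θ Λ hΘ hΛ
    obtain ⟨hA, hΘ'⟩ := (Finset.forall_mem_insert ..).1 hΘ
    exact LCE.contractL hA (LCE.impIL (ih₁ σ _ _ (weak hΘ) hΛ) (ih₂ σ _ _ (cons hΘ') hΛ))
  | impIR _ ih => exact fun σ Θ Λ hΘ hΛ => LCE.impIR (ih σ _ _ (cons hΘ) hΛ)
  | negL _ ih =>
    intro σ Θ Λ hΘ hΛ
    exact LCE.contractL (hΘ _ (Finset.mem_insert_self _ _)) (LCE.negL (ih σ _ _ (weak hΘ) hΛ))
  | negR _ ih =>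
    intro σ Θ Λ hΘ hΛ
    obtain ⟨hA, hΛ'⟩ := (Finset.forall_mem_insert ..).1 hΛ
    exact LCE.contractR hA (LCE.negR (ih σ _ _ (cons hΘ) hΛ'))
  | botL =>
    exact fun σ Θ Λ hΘ hΛ => LCE.contractL (hΘ _ (Finset.mem_insert_self _ _)) LCE.botL
  | @exIL Γ Δ S A y hΓ hΔ hS hA _ ih =>
    intro σ Θ Λ hΘ hΛ
    obtain ⟨hA', hΘ'⟩ := (Finset.forall_mem_insert ..).1 hΘ
    obtain ⟨z, hz⟩ := exists_fresh (Θ ∪ Λ ∪ (S.map (Fml.sub σ)).toFinset)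
    rw [Fml.sub_exI] at hA'
    have hS' : S.map (Fml.sub (Function.update σ y z)) = S.map (Fml.sub σ) :=
      Option.map_congr fun B hB => Fml.sub_update σ (hS B hB) z
    refine LCE.contractL hA' (LCE.exIL z (fun B hB => hz B (by simp [hB]))
      (fun B hB => hz B (by simp [hB])) (fun B hB => hz B ?_) (hz _ (by simp [hA'])) ?_)
    · exact Finset.mem_union_right _ (Option.mem_toFinset.2 hB)
    · rw [← Fml.sub_update_inst σ hA z, ← hS']
      exact ih _ _ _ (cons (upd hΓ hΘ')) (upd hΔ hΛ)
  | exIR y _ ih =>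
    intro σ Θ Λ hΘ hΛ
    rw [Option.map_some, Fml.sub_exI]
    refine LCE.exIR (σ y) ?_
    rw [← Fml.sub_inst]
    exact ih σ Θ Λ hΘ hΛ
  | allL y _ ih =>
    intro σ Θ Λ hΘ hΛ
    obtain ⟨hA, hΘ'⟩ := (Finset.forall_mem_insert ..).1 hΘ
    have h := ih σ _ _ (cons (cons hΘ')) hΛ
    rw [Fml.sub_all, Fml.sub_inst] at h
    rw [Fml.sub_all] at hA
    exact LCE.contractL hA (LCE.allL (σ y) h)
  | @allR Γ Δ A y hΓ hΔ hA _ ih =>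
    intro σ Θ Λ hΘ hΛ
    obtain ⟨z, hz⟩ := exists_fresh (insert ((all A).sub σ) (Θ ∪ Λ))
    rw [Option.map_some]
    rw [Fml.sub_all] at hz ⊢
    refine LCE.allR z (fun B hB => hz B (by simp [hB])) (fun B hB => hz B (by simp [hB]))
      (hz _ (Finset.mem_insert_self _ _)) ?_
    rw [← Fml.sub_update_inst σ hA z]
    exact ih _ _ _ (upd hΓ hΘ) (upd hΔ hΛ)
  | orCL _ _ ih₁ ih₂ =>
    intro σ Θ Λ hΘ hΛ
    obtain ⟨hA, hΘ'⟩ := (Finset.forall_mem_insert ..).1 hΘ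
    exact LCE.contractL hA (LCE.orCL (ih₁ σ _ _ (cons hΘ') hΛ) (ih₂ σ _ _ (cons hΘ') hΛ))
  | orCR _ ih =>
    intro σ Θ Λ hΘ hΛ
    obtain ⟨hA, hΛ'⟩ := (Finset.forall_mem_insert ..).1 hΛ
    exact LCE.contractR hA (LCE.orCR (ih σ _ _ hΘ (cons (cons hΛ'))))
  | impCL _ _ ih₁ ih₂ =>
    intro σ Θ Λ hΘ hΛ
    obtain ⟨hA, hΘ'⟩ := (Finset.forall_mem_insert ..).1 hΘ
    exact LCE.contractL hA (LCE.impCL (ih₁ σ _ _ (weak hΘ) hΛ) (ih₂ σ _ _ (cons hΘ') hΛ))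
  | impCR _ ih =>
    intro σ Θ Λ hΘ hΛ
    obtain ⟨hA, hΛ'⟩ := (Finset.forall_mem_insert ..).1 hΛ
    exact LCE.contractR hA (LCE.impCR (ih σ _ _ (cons hΘ) (cons hΛ')))
  | atomCL _ ih =>
    intro σ Θ Λ hΘ hΛ
    obtain ⟨hA, hΘ'⟩ := (Finset.forall_mem_insert ..).1 hΘ
    exact LCE.contractL hA (LCE.atomCL (ih σ _ _ (cons hΘ') hΛ))
  | atomCR _ ih =>
    intro σ Θ Λ hΘ hΛ
    obtain ⟨hA, hΛ'⟩ := (Finset.forall_mem_insert ..).1 hΛ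
    exact LCE.contractR hA (LCE.atomCR (ih σ _ _ hΘ (cons hΛ')))
  | @exCL Γ Δ A y hΓ hΔ hA _ ih =>
    intro σ Θ Λ hΘ hΛ
    obtain ⟨hA', hΘ'⟩ := (Finset.forall_mem_insert ..).1 hΘ
    obtain ⟨z, hz⟩ := exists_fresh (Θ ∪ Λ)
    rw [Fml.sub_exC] at hA'
    refine LCE.contractL hA' (LCE.exCL z (fun B hB => hz B (by simp [hB]))
      (fun B hB => hz B (by simp [hB])) (hz _ (by simp [hA'])) ?_)
    rw [← Fml.sub_update_inst σ hA z]
    exact ih _ _ _ (cons (upd hΓ hΘ')) (upd hΔ hΛ)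
  | exCR y _ ih =>
    intro σ Θ Λ hΘ hΛ
    obtain ⟨hA, hΛ'⟩ := (Finset.forall_mem_insert ..).1 hΛ
    have h := ih σ _ _ hΘ (cons (cons hΛ'))
    rw [Fml.sub_exC, Fml.sub_inst] at h
    rw [Fml.sub_exC] at hA
    exact LCE.contractR hA (LCE.exCR (σ y) h)
  | init => exact fun σ Θ Λ hΘ hΛ => LCE.of_mem (hΘ _ (Finset.mem_insert_self _ _))
  | der hA _ ih =>
    intro σ Θ Λ hΘ hΛ
    exact LCE.contractR (hΛ _ (Finset.mem_insert_self _ _))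
      (LCE.der ((Fml.positive_sub σ _).2 hA) (ih σ _ _ hΘ (weak hΛ)))
  | store hA _ ih =>
    exact fun σ Θ Λ hΘ hΛ => LCE.store ((Fml.negative_sub σ _).2 hA) (ih σ _ _ hΘ (cons hΛ))
  | weak _ ih => exact fun σ Θ Λ hΘ hΛ => LCE.weak (ih σ _ _ hΘ hΛ)
  | cutP hA _ _ ih₁ ih₂ =>
    exact fun σ Θ Λ hΘ hΛ =>
      LCE.cutP ((Fml.positive_sub σ _).2 hA) (ih₁ σ _ _ hΘ hΛ) (ih₂ σ _ _ (cons hΘ) hΛ)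
  | cutN hA hS' _ _ ih₁ ih₂ =>
    intro σ Θ Λ hΘ hΛ
    refine LCE.cutN ((Fml.negative_sub σ _).2 hA) ?_ (ih₁ σ _ _ hΘ (cons hΛ))
      (ih₂ σ _ _ (cons hΘ) hΛ)
    rcases hS' with rfl | ⟨B, hB, hB', rfl⟩
    · exact Or.inl rfl
    · exact Or.inr ⟨B.sub σ, hΛ B hB, (Fml.positive_sub σ _).2 hB', rfl⟩

theorem LCE.mono (h : LCE Γ Δ S) (hΘ : ∀ A ∈ Γ, A ∈ Θ) (hΛ : ∀ A ∈ Δ, A ∈ Λ) : LCE Θ Λ S := by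
  have hid : (Fml.sub id : Formula P → Formula P) = id := funext Fml.sub_id
  simpa only [hid, Option.map_id, id] using
    h.mono_sub id Θ Λ (by simpa only [Fml.sub_id] using hΘ) (by simpa only [Fml.sub_id] using hΛ)

/-- Cut on an arbitrary formula in the stoup. A negative `A` is cut through the positive formula
`A ∧ A`. -/
theorem LCE.cut (h₁ : LCE Γ Δ (some A)) (h₂ : LCE (insert A Γ) Δ S) : LCE Γ Δ S :=
  LCE.cutP (A := and A A) not_false (LCE.andR h₁ h₁)
    (LCE.andL (by rwa [Finset.insert_eq_of_mem (Finset.mem_insert_self A Γ)]))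

/-- Together with `LCE.weak`, makes the stoup ⊥ interchangeable with the empty stoup. -/
theorem LCE.of_bot (h : LCE Γ Δ (some bot)) : LCE Γ Δ none := LCE.cut h LCE.botL

/-- A negated formula on the left may be moved to the classical context. -/
theorem LCE.of_neg (hA : A ∈ Δ) (h : LCE (insert (neg A) Γ) Δ S) : LCE Γ Δ S :=
  -- The left premise Γ ⊢ Δ, ¬A comes from the identity A, Γ ⊢ Δ, with A in Δ.
  LCE.cutN (A := neg A) trivial (Or.inl rfl)
    (LCE.negR (LCE.of_mem_of_mem (Finset.mem_insert_self A Γ) hA)) h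

/-- The negations are cut one at a time. Λ is separate from Δ because Δ must stay whole while Λ
shrinks. -/
theorem LCE.of_neg_image (h : LCE (Γ ∪ Λ.image neg) Δ S) (hΛ : Λ ⊆ Δ) : LCE Γ Δ S := by
  induction Λ using Finset.induction_on with
  | empty => simpa using h
  | insert A Λ _ ih =>
    rw [Finset.insert_subset_iff] at hΛ
    refine ih (LCE.of_neg hΛ.1 ?_) hΛ.2
    rwa [Finset.image_insert, Finset.union_insert] at h

end LCE

/-! ### The translations -/

/-- The conclusion of a classical right rule is negative, so `store` puts it in the classical
context, where the LCE rule breaks it up. The negations in the LE premise are then removed by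
`LCE.of_neg`. -/
theorem LE.toLCE {Γ : Multiset (Formula P)} {C : Formula P} (h : LE Γ C) :
    LCE Γ.toFinset ∅ (some C) := by
  induction h with
  | andL _ ih => simp only [Multiset.toFinset_cons] at *; exact LCE.andL ih
  | andR _ _ ih₁ ih₂ => exact LCE.andR ih₁ ih₂
  | orIL _ _ ih₁ ih₂ => simp only [Multiset.toFinset_cons] at *; exact LCE.orIL ih₁ ih₂
  | orIR₁ _ ih => exact LCE.orIR₁ ih
  | orIR₂ _ ih => exact LCE.orIR₂ ih
  | impIL _ _ ih₁ ih₂ => simp only [Multiset.toFinset_cons] at *; exact LCE.impIL ih₁ ih₂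
  | impIR _ ih => simp only [Multiset.toFinset_cons] at *; exact LCE.impIR ih
  | negL _ ih => simp only [Multiset.toFinset_cons] at *; exact LCE.weak (LCE.negL ih)
  | negR _ ih =>
    simp only [Multiset.toFinset_cons] at *
    exact LCE.store trivial (LCE.negR ih.of_bot)
  | botL => simp only [Multiset.toFinset_cons]; exact LCE.botL
  | allL y _ ih =>
    simp only [Multiset.toFinset_cons] at *
    rw [Finset.insert_comm] at ih
    exact LCE.allL y ih
  | allR y hΓ hA _ ih => exact LCE.allR y (by simpa using hΓ) (by simp) hA ih
  | exIL y hΓ hA hC _ ih =>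
    simp only [Multiset.toFinset_cons] at *
    exact LCE.exIL y (by simpa using hΓ) (by simp) (by simpa using hC) hA ih
  | exIR y _ ih => exact LCE.exIR y ih
  | orCL _ _ ih₁ ih₂ =>
    simp only [Multiset.toFinset_cons] at *
    exact LCE.weak (LCE.orCL ih₁.of_bot ih₂.of_bot)
  | @orCR Γ A B _ ih =>
    simp only [Multiset.toFinset_cons] at *
    refine LCE.store trivial (LCE.orCR ?_)
    refine LCE.of_neg (A := B) (by simp) (LCE.of_neg (A := A) (by simp) ?_)
    exact ih.of_bot.mono (by simp) (by simp)
  | impCL _ _ ih₁ ih₂ =>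
    simp only [Multiset.toFinset_cons] at *
    exact LCE.weak (LCE.impCL ih₁ ih₂.of_bot)
  | @impCR Γ A B _ ih =>
    simp only [Multiset.toFinset_cons] at *
    refine LCE.store trivial (LCE.impCR (LCE.of_neg (A := B) (by simp) ?_))
    exact ih.of_bot.mono (by simp +contextual) (by simp)
  | atomCL _ ih => simp only [Multiset.toFinset_cons] at *; exact LCE.weak (LCE.atomCL ih.of_bot)
  | @atomCR Γ k p v _ ih =>
    simp only [Multiset.toFinset_cons] at *
    refine LCE.store trivial (LCE.atomCR (LCE.of_neg (A := atomI p v) (by simp) ?_))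
    exact ih.of_bot.mono (by simp) (by simp)
  | exCL y hΓ hA _ ih =>
    simp only [Multiset.toFinset_cons] at *
    exact LCE.weak (LCE.exCL y (by simpa using hΓ) (by simp) hA ih.of_bot)
  | @exCR Γ A _ ih =>
    simp only [Multiset.toFinset_cons] at *
    -- The LE premise has ∀¬A on the left, not a plain negation, so it is cut away directly: with
    -- ∃_c A in the classical context, ∀¬A is provable at a fresh variable.
    refine LCE.store trivial (LCE.cut (A := all (neg A)) ?_ (ih.of_bot.mono (by simp) (by simp)))
    obtain ⟨y, hy⟩ := exists_fresh (insert (exC A) Γ.toFinset)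
    have hA := hy _ (Finset.mem_insert_self _ _)
    refine LCE.allR y (fun B hB => hy B (Finset.mem_insert_of_mem hB)) (by simpa using hA) hA ?_
    refine LCE.store trivial (LCE.negR (LCE.exCR y ?_))
    exact LCE.of_mem_of_mem (A := A.inst y) (by simp [Fml.inst]) (by simp)
  | init => simp only [Multiset.toFinset_cons]; exact LCE.init
  | cut _ _ ih₁ ih₂ => simp only [Multiset.toFinset_cons] at *; exact LCE.cut ih₁ ih₂
  | weak _ ih => exact LCE.weak ih.of_bot

/-- The antecedent of the LE-sequent that translates an LCE-sequent. -/
def ctx (Γ Δ : Finset (Formula P)) : Multiset (Formula P) := Γ.val + Δ.val.map neg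

section ctx
variable {Γ Δ : Finset (Formula P)} {B : Formula P}

@[grind =] theorem mem_ctx : B ∈ ctx Γ Δ ↔ B ∈ Γ ∨ ∃ A ∈ Δ, neg A = B := by
  simp [ctx]

theorem not_freeIn_of_mem_ctx {y : ℕ} (hΓ : ∀ B ∈ Γ, ¬ B.FreeIn y) (hΔ : ∀ B ∈ Δ, ¬ B.FreeIn y) :
    ∀ B ∈ ctx Γ Δ, ¬ B.FreeIn y := by
  intro B hB
  rcases mem_ctx.1 hB with hB | ⟨A, hA, rfl⟩
  · exact hΓ B hB
  · exact hΔ A hA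

end ctx

/-- A classical right rule on A in Δ becomes `negL` on ¬A followed by the LE right rule.
Multiplicities in `ctx` do not match those of the rules, and `LE.mono` absorbs the difference. -/
theorem LCE.toLE {Γ Δ : Finset (Formula P)} {S : Option (Formula P)} (h : LCE Γ Δ S) :
    LE (ctx Γ Δ) (S.getD bot) := by
  induction h with
  | @andL Γ Δ S A B _ ih =>
    exact LE.contract (A := and A B) (by simp [mem_ctx]) (LE.andL (ih.mono (by grind)))
  | andR _ _ ih₁ ih₂ => exact LE.andR ih₁ ih₂
  | @orIL Γ Δ S A B _ _ ih₁ ih₂ =>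
    exact LE.contract (A := orI A B) (by simp [mem_ctx])
      (LE.orIL (ih₁.mono (by grind)) (ih₂.mono (by grind)))
  | orIR₁ _ ih => exact LE.orIR₁ ih
  | orIR₂ _ ih => exact LE.orIR₂ ih
  | @impIL Γ Δ S A B _ _ ih₁ ih₂ =>
    exact LE.contract (A := impI A B) (by simp [mem_ctx])
      (LE.impIL (ih₁.mono (by grind)) (ih₂.mono (by grind)))
  | impIR _ ih => exact LE.impIR (ih.mono (by grind))
  | @negL Γ Δ A _ ih => exact LE.negL_mem (A := A) (by simp [mem_ctx]) ih
  | @negR Γ Δ A _ ih =>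
    -- Here ¬A itself lies in the classical context, so ¬¬A is on the left.
    exact LE.negL_mem (A := neg A) (by simp [mem_ctx]) (LE.negR (ih.mono (by grind)))
  | botL => exact LE.contract (A := bot) (by simp [mem_ctx]) LE.botL
  | @exIL Γ Δ S A y hΓ hΔ hS hA _ ih =>
    refine LE.contract (A := exI A) (by simp [mem_ctx]) (LE.exIL y ?_ hA ?_ (ih.mono (by grind)))
    · exact not_freeIn_of_mem_ctx ((Finset.forall_mem_insert ..).2 ⟨hA, hΓ⟩) hΔ
    · cases S with
      | none => exact not_false
      | some B => exact hS B rfl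
  | exIR y _ ih => exact LE.exIR y ih
  | @allL Γ Δ S A y _ ih => exact LE.allL_mem (A := A) (by simp [mem_ctx]) y (ih.mono (by grind))
  | allR y hΓ hΔ hA _ ih => exact LE.allR y (not_freeIn_of_mem_ctx hΓ hΔ) hA ih
  | @orCL Γ Δ A B _ _ ih₁ ih₂ =>
    exact LE.contract (A := orC A B) (by simp [mem_ctx])
      (LE.orCL (ih₁.mono (by grind)) (ih₂.mono (by grind)))
  | @orCR Γ Δ A B _ ih =>
    exact LE.negL_mem (A := orC A B) (by simp [mem_ctx]) (LE.orCR (ih.mono (by grind)))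
  | @impCL Γ Δ A B _ _ ih₁ ih₂ =>
    exact LE.contract (A := impC A B) (by simp [mem_ctx])
      (LE.impCL (ih₁.mono (by grind)) (ih₂.mono (by grind)))
  | @impCR Γ Δ A B _ ih =>
    exact LE.negL_mem (A := impC A B) (by simp [mem_ctx]) (LE.impCR (ih.mono (by grind)))
  | @atomCL Γ Δ k p v _ ih =>
    exact LE.contract (A := atomC p v) (by simp [mem_ctx]) (LE.atomCL (ih.mono (by grind)))
  | @atomCR Γ Δ k p v _ ih =>
    exact LE.negL_mem (A := atomC p v) (by simp [mem_ctx]) (LE.atomCR (ih.mono (by grind)))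
  | @exCL Γ Δ A y hΓ hΔ hA _ ih =>
    refine LE.contract (A := exC A) (by simp [mem_ctx]) (LE.exCL y ?_ hA (ih.mono (by grind)))
    exact not_freeIn_of_mem_ctx ((Finset.forall_mem_insert ..).2 ⟨hA, hΓ⟩) hΔ
  | @exCR Γ Δ A y _ ih =>
    refine LE.negL_mem (A := exC A) (by simp [mem_ctx]) (LE.exCR ?_)
    exact LE.allL_mem (A := neg A) (by simp) y (ih.mono
      (Θ := neg (A.inst y) ::ₘ all (neg A) ::ₘ ctx Γ (insert (exC A) Δ)) (by grind))
  | init => exact LE.of_mem (by simp [mem_ctx])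
  | @der Γ Δ A _ _ ih => exact LE.negL_mem (A := A) (by simp [mem_ctx]) ih
  | store hA _ ih => exact LE.by_contra hA (ih.mono (by grind))
  | weak _ ih => exact LE.weak ih
  | cutP _ _ _ ih₁ ih₂ => exact LE.cut ih₁ (ih₂.mono (by grind))
  | @cutN Γ Δ S S' A hA hS' _ _ ih₁ ih₂ =>
    refine LE.cut (LE.by_contra hA (LE.mono (Γ := ctx Γ (insert A Δ)) ?_ (by grind)))
      (ih₂.mono (by grind))
    -- If the stoup of the left premise is some B in Δ, then ¬B is on the left and turns the
    -- conclusion B into ⊥.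
    rcases hS' with rfl | ⟨B, hB, -, rfl⟩
    · exact ih₁
    · exact LE.negL_mem (A := B) (by simp [mem_ctx, hB]) ih₁

end Ecumenical

/-! ### Equivalence of the two calculi. -/

theorem mainTheorem1 {P : ℕ → Type*} (Γ Δ : Finset (Ecumenical.Formula P))
    (S : Option (Ecumenical.Formula P)) :
    Ecumenical.LCE Γ Δ S ↔
      Ecumenical.LE (Γ.val + Δ.val.map Ecumenical.Fml.neg) (S.getD Ecumenical.Fml.bot) := by
  refine ⟨Ecumenical.LCE.toLE, fun h => ?_⟩
  -- `LE.toLCE` leaves ¬Δ on the left and the classical context empty. Weakening that context to Δ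
  -- lets all of ¬Δ be cut away.
  refine Ecumenical.LCE.of_neg_image (Λ := Δ) ?_ subset_rfl
  have h' := h.toLCE.mono (Θ := Γ ∪ Δ.image Ecumenical.Fml.neg) (Λ := Δ) (by simp) (by simp)
  cases S with
  | none => exact h'.of_bot
  | some A => exact h'
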